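/- **Theorem (very singular solutions of type I).** Let $N\ge 1$, $\tilde s\in(0,1)$ and $\tilde m\in\left(\frac{N-2+4\tilde s}{N+2\tilde s},\frac{N+2\tilde s}{N+2}\right)$, and put $\alpha=\frac{2-2\tilde s}{1-\tilde m}$. Consider on $\mathbb R^N$ the equation $$v_t=\nabla\cdot\big(v^{\tilde m-1}\nabla(-\Delta)^{-\tilde s}v\big).\tag{M2}$$ Then there is a constant $K>0$ such that $$v(x,t)=K\,t^{\frac1{1-\tilde m}}\,|x|^{-\frac{2-2\tilde s}{1-\tilde m}}$$ is a very singular solution of (M2). The constant is explicit: $$K^{1-\tilde m}=k(\alpha)\,(\alpha-2\tilde s)\,\big(N(\tilde m-1)+2-2\tilde s\big),\qquad k(\alpha)=2^{-2\tilde s}\,\frac{\Gamma\left(\frac{N-\alpha}2\right)\Gamma\left(\frac{\alpha-2\tilde s}2\right)}{\Gamma\left(\frac{\alpha}2\right)\Gamma\left(\frac{N-\alpha+2\tilde s}2\right)}.$$ Here a very singular solution is a function $v>0$ on $(\mathbb R^N\setminus\{0\})\times(0,\infty)$ of class $C^1$ such that: (i) for each $t>0$ there is a function $p(\cdot,t)=(-\Delta)^{-\tilde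 s}v(\cdot,t)$ of class $C^2$ on $\mathbb R^N\setminus\{0\}$, and $v_t=\nabla\cdot(v^{\tilde m-1}\nabla p)$ holds pointwise for $x\ne0$, $t>0$; (ii) $v(\cdot,t)\to0$ as $t\to0^+$, uniformly on $\{|x|\ge r\}$ for every $r>0$; (iii) $\int_{|x|<r}v(x,t)\,dx=\infty$ for all $t>0$, $r>0$. The relation $g=(-\Delta)^{-\tilde s}f$ is understood through the Fourier transform $\mathcal F f(\xi)=\int e^{-2\pi i x\cdot\xi}f(x)\,dx$ of tempered distributions: $\mathcal F f$ is a function and $\mathcal F g(\xi)=(2\pi|\xi|)^{-2\tilde s}\mathcal F f(\xi)$, where functions that are not locally integrable at the origin are read as tempered distributions by taking their Hadamard finite part there. -/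

import Mathlib

open Filter Topology MeasureTheory Set
open scoped SchwartzMap FourierTransform

namespace FractionalPressure

/-- `ℝ^N` with its Euclidean norm. -/
abbrev Space (N : ℕ) : Type := EuclideanSpace ℝ (Fin N)

/-- The tempered distribution `U` is the Hadamard finite part (at the origin) of the function `f`:
for every Schwartz function `φ`, the truncated integral `∫_{|x| > ε} f φ` is, up to finitely many
negative powers of `ε` and a multiple of `log ε`, convergent as `ε → 0⁺`, with limit `U φ`.
(Since no nontrivial combination of negative powers and `log ε` converges, `f` has at most one
finite part; if `f φ` is integrable for all `φ`, it is the distribution `φ ↦ ∫ f φ`.) -/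
def IsFinitePart {N : ℕ} (f : Space N → ℝ) (U : 𝓢'(Space N, ℂ)) : Prop :=
  ∀ φ : 𝓢(Space N, ℂ),
    (∀ ε : ℝ, 0 < ε → IntegrableOn (fun x => (f x : ℂ) * φ x) {x | ε < ‖x‖}) ∧
    ∃ (Λ : Finset ℝ) (c : ℝ → ℂ) (c₀ : ℂ), (∀ l ∈ Λ, 0 < l) ∧
      Tendsto
        (fun ε : ℝ => (∫ x in {x | ε < ‖x‖}, (f x : ℂ) * φ x)
          - ∑ l ∈ Λ, c l * ((ε ^ (-l) : ℝ) : ℂ) - c₀ * (Real.log ε : ℂ))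
        (𝓝[>] 0) (𝓝 (U φ))

/-- `g = (-Δ)^{-s} f`, in the sense of the Fourier transform: with `f` and `g` read as tempered
distributions (finite parts at the origin, if they are not locally integrable there), the Fourier
transform of `f` is a function `h`, and that of `g` is the function `(2π|ξ|)^{-2s} h(ξ)`.
(Mathlib's Fourier transform is `∫ e^{-2πi x·ξ} f(x) dx`, hence the factor `2π`.) -/
def IsInverseFractionalLaplacian {N : ℕ} (s : ℝ) (f g : Space N → ℝ) : Prop :=
  ∃ U P : 𝓢'(Space N, ℂ), IsFinitePart f U ∧ IsFinitePart g P ∧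
    ∃ h : Space N → ℂ, ∀ φ : 𝓢(Space N, ℂ),
      (Integrable (fun ξ => h ξ * φ ξ) ∧ 𝓕 U φ = ∫ ξ, h ξ * φ ξ) ∧
      (Integrable (fun ξ => (((2 * Real.pi * ‖ξ‖) ^ (-(2 * s)) : ℝ) : ℂ) * h ξ * φ ξ) ∧
        𝓕 P φ = ∫ ξ, (((2 * Real.pi * ‖ξ‖) ^ (-(2 * s)) : ℝ) : ℂ) * h ξ * φ ξ)

/-- The divergence `∑ᵢ ∂ᵢ Fᵢ` of a vector field. -/
noncomputable def divergence {N : ℕ} (F : Space N → Space N) (x : Space N) : ℝ :=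
  ∑ i : Fin N, fderiv ℝ F x (EuclideanSpace.single i 1) i

/-- `v` is a positive classical solution, for `t > 0` and `x ≠ 0`, of
`v_t = ∇ · (v^{m-1} ∇ p)`, `p = (-Δ)^{-s} v`, where the nonlocal operator acts on `v(t, ·)` as a
distribution on the whole of `ℝ^N`. -/
structure IsPuncturedSolution {N : ℕ} (s m : ℝ) (v : ℝ → Space N → ℝ) : Prop where
  pos : ∀ t > 0, ∀ x ≠ 0, 0 < v t x
  smooth : ContDiffOn ℝ 1 (fun z : ℝ × Space N => v z.1 z.2) (Ioi 0 ×ˢ {0}ᶜ)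
  equation : ∃ p : ℝ → Space N → ℝ, ∀ t > 0,
    IsInverseFractionalLaplacian s (v t) (p t) ∧
    ContDiffOn ℝ 2 (p t) {0}ᶜ ∧
    ∀ x ≠ 0, deriv (fun τ => v τ x) t =
      divergence (fun y => v t y ^ (m - 1) • gradient (p t) y) x

/-- A very singular solution: a positive solution off the origin, with zero initial data off the
origin and a standing singularity at the origin that carries infinite mass at all times. -/
structure IsVerySingularSolution {N : ℕ} (s m : ℝ) (v : ℝ → Space N → ℝ) : Prop
    extends IsPuncturedSolution s m v where
  initial : ∀ r > 0, TendstoUniformlyOn v 0 (𝓝[>] 0) {x | r ≤ ‖x‖}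
  singular : ∀ t > 0, ∀ r > 0, ∫⁻ x in Metric.ball 0 r, ENNReal.ofReal (v t x) = ⊤

/-- The constant `k(α)` in `(-Δ)^{-s} |x|^{-α} = k(α) |x|^{-α+2s}` on `ℝ^N`. -/
noncomputable def rieszConst (N : ℕ) (s α : ℝ) : ℝ :=
  (2 : ℝ) ^ (-(2 * s)) *
    (Real.Gamma ((N - α) / 2) * Real.Gamma ((α - 2 * s) / 2)) /
    (Real.Gamma (α / 2) * Real.Gamma ((N - α + 2 * s) / 2))

end FractionalPressure

namespace FractionalPressure

/-! The hypothesis on `m` amounts to `N + 2s < α < N + 2`, with `α = (2 - 2s)/(1 - m)`. Hence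
`|x|^{-α}` and `|x|^{-(α-2s)}` both have the form `|x|^{-N-γ}` with `0 < γ < 2`. Neither is locally
integrable, but after averaging over `±x` a single subtraction of `φ(0)` regularises the pairing
with a Schwartz function `φ`.

The transform of such a finite part is then the Lévy–Khintchine integral of `|x|^{-N-γ} (cos (2π
x·ξ) - 1)`, a negative multiple of `|ξ|^γ`. It is computed in `lintegral_norm_rpow_mul_one_sub_cos`
by writing the power as a mixture of Gaussians, and carried to Schwartz functions by Fubini
(`integral_norm_rpow_mul_symm_diff`, `exists_isFinitePart_norm_rpow`). Comparing the constants for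
`α` and `α - 2s` gives `k(α)` (`rieszConst_mul_kernelConst`).

With the pressure known, the choice of `α` balances the powers of `|x|`, the exponent `1/(1-m)`
balances those of `t`, and one algebraic equation for `K` remains. Its right side is positive
because `k(α) > 0`, `α > 2s` and `α > N`. Infinite mass also comes from `α > N`, and the initial
condition from `t^{1/(1-m)} → 0`. -/

/-! ### Gamma integrals -/

open Real in
lemma lintegral_rpow_mul_exp_neg_div {b r : ℝ} (hb : b < 1) (hr : 0 < r) :
    ∫⁻ t in Ioi (0 : ℝ), ENNReal.ofReal (t ^ (b - 2) * exp (-(r / t))) =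
      ENNReal.ofReal (Gamma (1 - b) * r ^ (b - 1)) := by
  -- The inversion `t ↦ 1/t`, with Jacobian `t^{-2}`, leads to the Gamma integral with parameter `1
  -- - b`.
  have hcongr : EqOn (fun t : ℝ => (|(-1 : ℝ)| * t ^ ((-1 : ℝ) - 1)) •
      ((t ^ (-1 : ℝ)) ^ ((1 - b) - 1) * exp (-(r * t ^ (-1 : ℝ)))))
      (fun t => t ^ (b - 2) * exp (-(r / t))) (Ioi 0) := by
    intro t (ht : 0 < t)
    simp only [abs_neg, abs_one, one_mul, smul_eq_mul]
    rw [← rpow_mul ht.le, ← mul_assoc, ← rpow_add ht, rpow_neg_one, ← div_eq_mul_inv]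
    ring_nf
  have hint : IntegrableOn (fun t : ℝ => t ^ ((1 - b) - 1) * exp (-(r * t))) (Ioi 0) := by
    have := integrableOn_rpow_mul_exp_neg_mul_rpow (s := (1 - b) - 1) (p := 1) (b := r)
      (by linarith) one_pos hr
    simpa using this
  have hval := integral_rpow_mul_exp_neg_mul_Ioi (a := 1 - b) (r := r) (by linarith) hr
  have hint' := (integrableOn_Ioi_comp_rpow_iff
    (fun t : ℝ => t ^ ((1 - b) - 1) * exp (-(r * t))) (p := -1) (by norm_num)).2 hint
  have hval' := integral_comp_rpow_Ioi
    (fun t : ℝ => t ^ ((1 - b) - 1) * exp (-(r * t))) (p := -1) (by norm_num)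
  rw [hval] at hval'
  rw [integrableOn_congr_fun hcongr measurableSet_Ioi] at hint'
  rw [setIntegral_congr_fun measurableSet_Ioi hcongr] at hval'
  rw [← ofReal_integral_eq_lintegral_ofReal hint', hval']
  · congr 1
    rw [one_div, inv_rpow hr.le, ← rpow_neg hr.le]
    ring_nf
  · filter_upwards [ae_restrict_mem measurableSet_Ioi] with t (ht : 0 < t)
    positivity

open Real in
lemma lintegral_Ioc_exp_neg_div {c t : ℝ} (hc : 0 ≤ c) (ht : 0 < t) :
    ∫⁻ r in Ioc 0 c, ENNReal.ofReal (exp (-(r / t))) =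
      ENNReal.ofReal (t * (1 - exp (-(c / t)))) := by
  have hcont : Continuous fun r : ℝ => exp (-(r / t)) := by fun_prop
  rw [← ofReal_integral_eq_lintegral_ofReal (hcont.integrableOn_Ioc)
    (.of_forall fun r => (exp_pos _).le), ← intervalIntegral.integral_of_le hc]
  congr 1
  have hder : ∀ r ∈ uIcc 0 c, HasDerivAt (fun r : ℝ => -t * exp (-(r / t))) (exp (-(r / t))) r := by
    intro r _
    have := (((hasDerivAt_id r).div_const t).neg.exp).const_mul (-t)
    convert! this using 1
    simp only [Pi.neg_apply, id]
    field_simp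
  rw [intervalIntegral.integral_eq_sub_of_hasDerivAt hder (hcont.intervalIntegrable _ _)]
  simp
  ring

open Real in
lemma lintegral_Ioc_rpow_sub_one {b c : ℝ} (hb : 0 < b) (hc : 0 ≤ c) :
    ∫⁻ r in Ioc 0 c, ENNReal.ofReal (r ^ (b - 1)) = ENNReal.ofReal (c ^ b / b) := by
  have hint : IntervalIntegrable (fun r : ℝ => r ^ (b - 1)) volume 0 c :=
    intervalIntegral.intervalIntegrable_rpow' (by linarith)
  rw [← ofReal_integral_eq_lintegral_ofReal ((intervalIntegrable_iff_integrableOn_Ioc_of_le hc).1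
    hint), ← intervalIntegral.integral_of_le hc, integral_rpow (by left; linarith)]
  · simp [zero_rpow hb.ne']
  · filter_upwards [ae_restrict_mem measurableSet_Ioc] with r hr
    exact rpow_nonneg hr.1.le _

open Real in
/-- A formula for `-Γ(-b) c^b`. -/
lemma lintegral_rpow_mul_one_sub_exp_neg_div {b c : ℝ} (hb : b ∈ Ioo (0 : ℝ) 1) (hc : 0 ≤ c) :
    ∫⁻ t in Ioi (0 : ℝ), ENNReal.ofReal (t ^ (b - 1) * (1 - exp (-(c / t)))) =
      ENNReal.ofReal (Gamma (1 - b) / b * c ^ b) := by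
  have hΓ : 0 < Gamma (1 - b) := Gamma_pos_of_pos (by linarith [hb.2])
  calc ∫⁻ t in Ioi (0 : ℝ), ENNReal.ofReal (t ^ (b - 1) * (1 - exp (-(c / t))))
    -- Writing `1 - e^{-c/t}` as `t⁻¹ ∫_0^c e^{-r/t} dr` makes Tonelli applicable and lowers the
    -- exponent of `t` by one.
    _ = ∫⁻ t in Ioi (0 : ℝ), ∫⁻ r in Ioc 0 c,
          ENNReal.ofReal (t ^ (b - 2) * exp (-(r / t))) := by
        refine setLIntegral_congr_fun measurableSet_Ioi fun t (ht : 0 < t) => ?_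
        simp_rw [ENNReal.ofReal_mul (rpow_nonneg ht.le (b - 2))]
        rw [lintegral_const_mul _ (by fun_prop), lintegral_Ioc_exp_neg_div hc ht,
          ← ENNReal.ofReal_mul (rpow_nonneg ht.le _), ← mul_assoc]
        congr 2
        rw [← rpow_add_one ht.ne']
        ring_nf
    _ = ∫⁻ r in Ioc 0 c, ∫⁻ t in Ioi (0 : ℝ),
          ENNReal.ofReal (t ^ (b - 2) * exp (-(r / t))) := by
        refine lintegral_lintegral_swap ?_
        refine Measurable.aemeasurable ?_
        simp only [Function.uncurry_def]
        fun_prop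
    _ = ∫⁻ r in Ioc 0 c, ENNReal.ofReal (Gamma (1 - b)) * ENNReal.ofReal (r ^ (b - 1)) := by
        refine setLIntegral_congr_fun measurableSet_Ioc fun r hr => ?_
        rw [lintegral_rpow_mul_exp_neg_div hb.2 hr.1, ENNReal.ofReal_mul hΓ.le]
    _ = ENNReal.ofReal (Gamma (1 - b) / b * c ^ b) := by
        rw [lintegral_const_mul _ (by fun_prop), lintegral_Ioc_rpow_sub_one hb.1 hc,
          ← ENNReal.ofReal_mul hΓ.le]
        congr 1
        ring

-- Subordination: a negative power of `ρ` is a mixture of the Gaussians `e^{-π t ρ²}`.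
open Real in
lemma lintegral_rpow_mul_exp_neg_pi_mul {a ρ : ℝ} (ha : 0 < a) (hρ : 0 < ρ) :
    ∫⁻ t in Ioi (0 : ℝ), ENNReal.ofReal (t ^ (a - 1) * exp (-(π * t * ρ ^ 2))) =
      ENNReal.ofReal (Gamma a / π ^ a * ρ ^ (-(2 * a))) := by
  have hr : 0 < π * ρ ^ 2 := by positivity
  have hint : IntegrableOn (fun t : ℝ => t ^ (a - 1) * exp (-(π * t * ρ ^ 2))) (Ioi 0) := by
    have := integrableOn_rpow_mul_exp_neg_mul_rpow (s := a - 1) (p := 1) (b := π * ρ ^ 2)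
      (by linarith) one_pos hr
    refine this.congr_fun (fun t _ => ?_) measurableSet_Ioi
    simp only [rpow_one]
    ring_nf
  rw [← ofReal_integral_eq_lintegral_ofReal hint]
  · congr 1
    have := integral_rpow_mul_exp_neg_mul_Ioi ha hr
    rw [← setIntegral_congr_fun measurableSet_Ioi (fun t _ => ?_), this]
    · rw [one_div, inv_rpow hr.le, mul_rpow pi_pos.le (by positivity), ← rpow_natCast, ← rpow_mul hρ.le,
        rpow_neg hρ.le]
      push_cast
      field_simp
    · ring_nf
  · filter_upwards [ae_restrict_mem measurableSet_Ioi] with t (ht : 0 < t)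
    positivity

/-! ### The Lévy–Khintchine integral -/

section Kernel

variable {E : Type*} [NormedAddCommGroup E] [InnerProductSpace ℝ E] [FiniteDimensional ℝ E]
  [MeasurableSpace E] [BorelSpace E]

-- This is the real part of the difference of the Gaussian's Fourier integrals at frequencies `0`
-- and `ξ`. The nonnegative form is what Tonelli needs later.
open Real in
lemma lintegral_gaussian_mul_one_sub_cos {t : ℝ} (ht : 0 < t) (ξ : E) :
    ∫⁻ x : E, ENNReal.ofReal (exp (-(π * t * ‖x‖ ^ 2)) * (1 - cos (2 * π * inner ℝ x ξ))) =
      ENNReal.ofReal (t ^ (-(Module.finrank ℝ E / 2 : ℝ)) * (1 - exp (-(π * ‖ξ‖ ^ 2 / t)))) := by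
  have hb : 0 < ((π * t : ℝ) : ℂ).re := by
    rw [Complex.ofReal_re]; positivity
  have h1 := GaussianFourier.integrable_cexp_neg_mul_sq_norm_add hb 0 ξ
  have h2 := GaussianFourier.integrable_cexp_neg_mul_sq_norm_add hb (2 * π * Complex.I) ξ
  have e1 := GaussianFourier.integral_cexp_neg_mul_sq_norm_add hb 0 ξ
  have e2 := GaussianFourier.integral_cexp_neg_mul_sq_norm_add hb (2 * π * Complex.I) ξ
  have hre : ∀ x : E, (Complex.exp (-((π * t : ℝ) : ℂ) * ‖x‖ ^ 2 + 0 * (inner ℝ ξ x : ℝ))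
      - Complex.exp (-((π * t : ℝ) : ℂ) * ‖x‖ ^ 2 + 2 * π * Complex.I * (inner ℝ ξ x : ℝ))).re
      = exp (-(π * t * ‖x‖ ^ 2)) * (1 - cos (2 * π * inner ℝ x ξ)) := by
    intro x
    rw [Complex.sub_re, Complex.exp_re, Complex.exp_re, real_inner_comm]
    simp [← Complex.ofReal_pow]
    ring
  have hint := (h1.sub h2).re
  have hval : ∫ x : E, exp (-(π * t * ‖x‖ ^ 2)) * (1 - cos (2 * π * inner ℝ x ξ)) =
      t ^ (-(Module.finrank ℝ E / 2 : ℝ)) * (1 - exp (-(π * ‖ξ‖ ^ 2 / t))) := by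
    simp_rw [← hre]
    have := integral_re (h1.sub h2)
    simp only [Pi.sub_apply] at this
    rw [integral_sub h1 h2, e1, e2] at this
    refine this.trans ?_
    have hpt : ((π : ℂ) / ((π * t : ℝ) : ℂ)) ^ ((Module.finrank ℝ E : ℂ) / 2) =
        ((t ^ (-(Module.finrank ℝ E / 2 : ℝ)) : ℝ) : ℂ) := by
      have : (π : ℂ) / ((π * t : ℝ) : ℂ) = ((t⁻¹ : ℝ) : ℂ) := by
        have : (π : ℂ) ≠ 0 := by exact_mod_cast pi_ne_zero
        push_cast
        field_simp
      rw [this, rpow_neg ht.le, ← inv_rpow ht.le, Complex.ofReal_cpow (by positivity)]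
      push_cast
      rfl
    have hexp : (2 * (π : ℂ) * Complex.I) ^ 2 * (‖ξ‖ : ℂ) ^ 2 / (4 * ((π * t : ℝ) : ℂ)) =
        ((-(π * ‖ξ‖ ^ 2 / t) : ℝ) : ℂ) := by
      have : (π : ℂ) ≠ 0 := by exact_mod_cast pi_ne_zero
      have : (t : ℂ) ≠ 0 := by exact_mod_cast ht.ne'
      push_cast
      rw [mul_pow, mul_pow, Complex.I_sq]
      field_simp
      ring
    rw [hpt, hexp]
    simp only [ne_eq, OfNat.ofNat_ne_zero, not_false_eq_true, zero_pow, zero_mul, zero_div,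
      Complex.exp_zero, mul_one, ← Complex.ofReal_exp]
    rw [← Complex.ofReal_mul, ← Complex.ofReal_sub]
    rw [show ∀ r : ℝ, RCLike.re (r : ℂ) = r from Complex.ofReal_re]
    ring
  rw [← hval, ofReal_integral_eq_lintegral_ofReal]
  · refine hint.congr (.of_forall fun x => ?_)
    exact hre x
  · refine .of_forall fun x => ?_
    have := cos_le_one (2 * π * inner ℝ x ξ)
    have : 0 ≤ 1 - cos (2 * π * inner ℝ x ξ) := by linarith
    positivity

open Real in
/-- The constant `c` in `∫ |x|^{-(d+γ)} (cos (2π x·ξ) - 1) dx = c |ξ|^γ` in dimension `d`. -/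
noncomputable def kernelConst (d : ℕ) (γ : ℝ) : ℝ :=
  π ^ (γ + d / 2) * Gamma (-(γ / 2)) / Gamma ((d + γ) / 2)

-- The recursion `Γ(z + 1) = z Γ(z)` at `z = -γ/2` trades the negative Gamma value for a positive
-- one, which exposes the sign and the product that subordination produces.
open Real in
lemma kernelConst_eq {d : ℕ} {γ : ℝ} (hγ : γ ∈ Ioo (0 : ℝ) 2) :
    kernelConst d γ = -(π ^ ((d + γ) / 2) / Gamma ((d + γ) / 2) *
      (Gamma (1 - γ / 2) / (γ / 2) * π ^ (γ / 2))) := by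
  have h : Gamma (1 - γ / 2) = -(γ / 2) * Gamma (-(γ / 2)) := by
    rw [← Gamma_add_one (by have := hγ.1; simp; linarith)]
    ring_nf
  have hp : π ^ (γ + d / 2 : ℝ) = π ^ ((d + γ) / 2 : ℝ) * π ^ (γ / 2) := by
    rw [← rpow_add pi_pos]
    ring_nf
  have := hγ.1.ne'
  rw [kernelConst, h, hp]
  field_simp

open Real in
lemma kernelConst_neg {d : ℕ} {γ : ℝ} (hγ : γ ∈ Ioo (0 : ℝ) 2) : kernelConst d γ < 0 := by
  obtain ⟨h0, h2⟩ := hγ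
  have h1 : 0 < Gamma ((d + γ) / 2) := Gamma_pos_of_pos (by positivity)
  have h3 : 0 < Gamma (1 - γ / 2) := Gamma_pos_of_pos (by linarith)
  rw [kernelConst_eq ⟨h0, h2⟩, neg_lt_zero]
  positivity

-- Subordination turns the power into Gaussians, whose integrals against `1 - cos` are known. The
-- remaining `t`-integral is again of Gamma type, and converges because `0 < γ/2 < 1`. All
-- integrands are nonnegative, so the interchange needs no integrability.
open Real in
lemma lintegral_norm_rpow_mul_one_sub_cos {γ : ℝ} (hγ : γ ∈ Ioo (0 : ℝ) 2) (ξ : E) :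
    ∫⁻ x : E, ENNReal.ofReal
      (‖x‖ ^ (-(Module.finrank ℝ E + γ)) * (1 - cos (2 * π * inner ℝ x ξ))) =
      ENNReal.ofReal (-kernelConst (Module.finrank ℝ E) γ * ‖ξ‖ ^ γ) := by
  set d := Module.finrank ℝ E
  have hγ0 := hγ.1
  have ha : 0 < (d + γ) / 2 := by positivity
  have hΓ : 0 < Gamma ((d + γ) / 2) := Gamma_pos_of_pos ha
  have hcos : ∀ x : E, 0 ≤ 1 - cos (2 * π * inner ℝ x ξ) := fun x => by
    linarith [cos_le_one (2 * π * inner ℝ x ξ)]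
  set A := π ^ ((d + γ) / 2) / Gamma ((d + γ) / 2) with hA
  have hA0 : 0 < A := by positivity
  calc ∫⁻ x : E, ENNReal.ofReal (‖x‖ ^ (-(d + γ)) * (1 - cos (2 * π * inner ℝ x ξ)))
    _ = ∫⁻ x : E, ENNReal.ofReal A * ∫⁻ t in Ioi (0 : ℝ), ENNReal.ofReal
          (t ^ ((d + γ) / 2 - 1) * exp (-(π * t * ‖x‖ ^ 2)) *
            (1 - cos (2 * π * inner ℝ x ξ))) := by
        refine lintegral_congr fun x => ?_
        -- Subordination needs `x ≠ 0`; at the origin `1 - cos` vanishes on both sides.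
        rcases eq_or_ne x 0 with rfl | hx
        · simp
        simp_rw [fun t : ℝ => ENNReal.ofReal_mul' (p := t ^ ((d + γ) / 2 - 1) *
          exp (-(π * t * ‖x‖ ^ 2))) (hcos x)]
        rw [lintegral_mul_const _ (by fun_prop),
          lintegral_rpow_mul_exp_neg_pi_mul ha (norm_pos_iff.2 hx), ← mul_assoc,
          ← ENNReal.ofReal_mul hA0.le, ← ENNReal.ofReal_mul' (hcos x)]
        congr 2
        rw [hA, ← mul_assoc]
        field_simp
    _ = ENNReal.ofReal A * ∫⁻ t in Ioi (0 : ℝ), ∫⁻ x : E, ENNReal.ofReal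
          (t ^ ((d + γ) / 2 - 1) * exp (-(π * t * ‖x‖ ^ 2)) *
            (1 - cos (2 * π * inner ℝ x ξ))) := by
        have hm : Measurable (Function.uncurry fun (x : E) (t : ℝ) => ENNReal.ofReal
          (t ^ ((d + γ) / 2 - 1) * exp (-(π * t * ‖x‖ ^ 2)) *
            (1 - cos (2 * π * inner ℝ x ξ)))) := by
          simp only [Function.uncurry_def]
          fun_prop
        have hm' : Measurable fun x : E => ∫⁻ t in Ioi (0 : ℝ), ENNReal.ofReal
          (t ^ ((d + γ) / 2 - 1) * exp (-(π * t * ‖x‖ ^ 2)) *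
            (1 - cos (2 * π * inner ℝ x ξ))) := hm.lintegral_prod_right'
        rw [lintegral_const_mul _ hm', lintegral_lintegral_swap hm.aemeasurable]
    _ = ENNReal.ofReal A * ∫⁻ t in Ioi (0 : ℝ), ENNReal.ofReal
          (t ^ (γ / 2 - 1) * (1 - exp (-(π * ‖ξ‖ ^ 2 / t)))) := by
        congr 1
        refine setLIntegral_congr_fun measurableSet_Ioi fun t (ht : 0 < t) => ?_
        simp_rw [mul_assoc (t ^ ((d + γ) / 2 - 1)),
          ENNReal.ofReal_mul (rpow_nonneg ht.le ((d + γ) / 2 - 1))]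
        rw [lintegral_const_mul _ (by fun_prop)]
        have hgauss := lintegral_gaussian_mul_one_sub_cos ht ξ
        change _ = ENNReal.ofReal (t ^ (-(d / 2 : ℝ)) * _) at hgauss
        rw [hgauss, ← ENNReal.ofReal_mul (rpow_nonneg ht.le _), ← mul_assoc, ← rpow_add ht]
        congr 3
        ring_nf
    _ = ENNReal.ofReal (-kernelConst d γ * ‖ξ‖ ^ γ) := by
        rw [lintegral_rpow_mul_one_sub_exp_neg_div ⟨by linarith, by linarith [hγ.2]⟩
          (by positivity), ← ENNReal.ofReal_mul hA0.le, kernelConst_eq hγ, ← hA]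
        congr 1
        rw [mul_rpow pi_pos.le (by positivity), ← rpow_natCast, ← rpow_mul (norm_nonneg _)]
        push_cast
        rw [mul_div_cancel₀ _ (two_ne_zero)]
        ring

end Kernel

/-! ### Passing from plane waves to Schwartz functions -/

section Kernel

variable {E : Type*} [NormedAddCommGroup E] [InnerProductSpace ℝ E] [FiniteDimensional ℝ E]
  [MeasurableSpace E] [BorelSpace E]

local notation "dim" => Module.finrank ℝ

lemma one_sub_cos_nonneg (r : ℝ) : 0 ≤ 1 - Real.cos r := by
  linarith [Real.cos_le_one r]

lemma integrable_norm_rpow_mul_one_sub_cos {γ : ℝ} (hγ : γ ∈ Ioo (0 : ℝ) 2) (ξ : E) :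
    Integrable fun x : E => ‖x‖ ^ (-(dim E + γ)) * (1 - Real.cos (2 * Real.pi * inner ℝ x ξ)) := by
  refine (lintegral_ofReal_ne_top_iff_integrable ?_ (.of_forall fun x => ?_)).1 ?_
  · exact Measurable.aestronglyMeasurable (by fun_prop)
  · exact mul_nonneg (Real.rpow_nonneg (norm_nonneg _) _) (one_sub_cos_nonneg _)
  · rw [lintegral_norm_rpow_mul_one_sub_cos hγ]
    exact ENNReal.ofReal_ne_top

lemma integral_norm_rpow_mul_one_sub_cos {γ : ℝ} (hγ : γ ∈ Ioo (0 : ℝ) 2) (ξ : E) :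
    ∫ x : E, ‖x‖ ^ (-(dim E + γ)) * (1 - Real.cos (2 * Real.pi * inner ℝ x ξ)) =
      -kernelConst (dim E) γ * ‖ξ‖ ^ γ := by
  rw [integral_eq_lintegral_of_nonneg_ae (.of_forall fun x => ?_)
    (Measurable.aestronglyMeasurable (by fun_prop)), lintegral_norm_rpow_mul_one_sub_cos hγ,
    ENNReal.toReal_ofReal]
  · exact mul_nonneg (neg_nonneg.2 (kernelConst_neg hγ).le) (Real.rpow_nonneg (norm_nonneg _) _)
  · exact mul_nonneg (Real.rpow_nonneg (norm_nonneg _) _) (one_sub_cos_nonneg _)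

lemma rpow_le_one_add_sq {r γ : ℝ} (hr : 0 ≤ r) (hγ : γ ∈ Icc (0 : ℝ) 2) :
    r ^ γ ≤ 1 + r ^ 2 := by
  rcases le_total r 1 with h | h
  · have := Real.rpow_le_one hr h hγ.1
    nlinarith
  · have := Real.rpow_le_rpow_of_exponent_le h hγ.2
    rw [Real.rpow_two] at this
    linarith

lemma integrable_norm_rpow_mul_schwartzMap {γ : ℝ} (hγ : γ ∈ Icc (0 : ℝ) 2) (ψ : 𝓢(E, ℂ)) :
    Integrable fun ξ : E => ((‖ξ‖ ^ γ : ℝ) : ℂ) * ψ ξ := by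
  have h := (ψ.integrable_pow_mul volume 0).add (ψ.integrable_pow_mul volume 2)
  refine h.mono' ?_ (.of_forall fun ξ => ?_)
  · exact AEStronglyMeasurable.mul (Measurable.aestronglyMeasurable (by fun_prop))
      ψ.continuous.aestronglyMeasurable
  · have := rpow_le_one_add_sq (norm_nonneg ξ) hγ
    rw [norm_mul, Complex.norm_real, Real.norm_of_nonneg (Real.rpow_nonneg (norm_nonneg _) _)]
    simp only [pow_zero, Pi.add_apply]
    rw [← add_mul]
    gcongr

/-- The hypothesis of Fubini: integrating the absolute value in `x` first leaves a multiple of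
`|ξ|^γ |ψ(ξ)|`. -/
lemma integrable_prod_norm_rpow_mul_one_sub_cos {γ : ℝ} (hγ : γ ∈ Ioo (0 : ℝ) 2) (ψ : 𝓢(E, ℂ)) :
    Integrable (fun z : E × E => ((‖z.1‖ ^ (-(dim E + γ)) *
      (1 - Real.cos (2 * Real.pi * inner ℝ z.1 z.2)) : ℝ) : ℂ) * ψ z.2)
      (volume.prod volume) := by
  have hm : AEStronglyMeasurable (fun z : E × E => ((‖z.1‖ ^ (-(dim E + γ)) *
      (1 - Real.cos (2 * Real.pi * inner ℝ z.1 z.2)) : ℝ) : ℂ) * ψ z.2)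
      (volume.prod volume) :=
    AEStronglyMeasurable.mul (Measurable.aestronglyMeasurable (by fun_prop))
      (ψ.continuous.comp continuous_snd).aestronglyMeasurable
  rw [integrable_prod_iff' hm]
  refine ⟨.of_forall fun ξ => (integrable_norm_rpow_mul_one_sub_cos hγ ξ).ofReal.mul_const (ψ ξ), ?_⟩
  have hnorm : ∀ ξ : E, ∫ x : E, ‖((‖x‖ ^ (-(dim E + γ)) *
      (1 - Real.cos (2 * Real.pi * inner ℝ x ξ)) : ℝ) : ℂ) * ψ ξ‖ =
      -kernelConst (dim E) γ * ‖((‖ξ‖ ^ γ : ℝ) : ℂ) * ψ ξ‖ := by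
    intro ξ
    simp_rw [norm_mul, Complex.norm_real, Real.norm_of_nonneg (mul_nonneg
      (Real.rpow_nonneg (norm_nonneg _) _) (one_sub_cos_nonneg _)),
      Real.norm_of_nonneg (Real.rpow_nonneg (norm_nonneg _) _)]
    rw [integral_mul_const, integral_norm_rpow_mul_one_sub_cos hγ, mul_assoc]
  simp_rw [hnorm]
  exact (integrable_norm_rpow_mul_schwartzMap (Ioo_subset_Icc_self hγ) ψ).norm.const_mul _

lemma integral_one_sub_cos_mul_schwartzMap (ψ : 𝓢(E, ℂ)) (x : E) :
    ∫ ξ : E, ((1 - Real.cos (2 * Real.pi * inner ℝ x ξ) : ℝ) : ℂ) * ψ ξ =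
      𝓕 ψ 0 - (𝓕 ψ x + 𝓕 ψ (-x)) / 2 := by
  have hF : ∀ y : E, Integrable (fun ξ : E =>
      Complex.exp (((-2 * Real.pi * inner ℝ ξ y : ℝ) : ℂ) * Complex.I) • ψ ξ) := by
    intro y
    have hc : Continuous fun ξ : E =>
        Complex.exp (((-2 * Real.pi * inner ℝ ξ y : ℝ) : ℂ) * Complex.I) • ψ ξ := by
      have := ψ.continuous
      fun_prop
    refine ψ.integrable.mono hc.aestronglyMeasurable (.of_forall fun ξ => ?_)
    rw [norm_smul, Complex.norm_exp_ofReal_mul_I, one_mul]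
  have hsub := integral_sub (hF 0) (((hF x).add (hF (-x))).div_const 2)
  simp only [Pi.add_apply] at hsub
  rw [SchwartzMap.fourier_coe, Real.fourier_eq', Real.fourier_eq', Real.fourier_eq',
    ← integral_add (hF x) (hF (-x)), ← integral_div, ← hsub]
  refine integral_congr_ae (.of_forall fun ξ => ?_)
  simp only [inner_zero_right, mul_zero, Complex.ofReal_zero, zero_mul, Complex.exp_zero,
    inner_neg_right, smul_eq_mul, one_mul]
  rw [real_inner_comm]
  push_cast
  rw [Complex.cos]
  ring_nf

/-- The second symmetric difference of a Fourier transform, integrated against `|x|^{-d-γ}`. -/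
lemma integrable_norm_rpow_mul_symm_diff {γ : ℝ} (hγ : γ ∈ Ioo (0 : ℝ) 2) (ψ : 𝓢(E, ℂ)) :
    Integrable fun x : E => ((‖x‖ ^ (-(dim E + γ)) : ℝ) : ℂ) *
      (𝓕 ψ 0 - (𝓕 ψ x + 𝓕 ψ (-x)) / 2) := by
  refine (integrable_prod_norm_rpow_mul_one_sub_cos hγ ψ).integral_prod_left.congr
    (.of_forall fun x => ?_)
  simp only [Complex.ofReal_mul, mul_assoc]
  rw [integral_const_mul, ← integral_one_sub_cos_mul_schwartzMap]
  simp only [mul_assoc]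

lemma integral_norm_rpow_mul_symm_diff {γ : ℝ} (hγ : γ ∈ Ioo (0 : ℝ) 2) (ψ : 𝓢(E, ℂ)) :
    ∫ x : E, ((‖x‖ ^ (-(dim E + γ)) : ℝ) : ℂ) * (𝓕 ψ 0 - (𝓕 ψ x + 𝓕 ψ (-x)) / 2) =
      -kernelConst (dim E) γ * ∫ ξ : E, ((‖ξ‖ ^ γ : ℝ) : ℂ) * ψ ξ := by
  calc ∫ x : E, ((‖x‖ ^ (-(dim E + γ)) : ℝ) : ℂ) * (𝓕 ψ 0 - (𝓕 ψ x + 𝓕 ψ (-x)) / 2)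
    _ = ∫ x : E, ∫ ξ : E, ((‖x‖ ^ (-(dim E + γ)) *
          (1 - Real.cos (2 * Real.pi * inner ℝ x ξ)) : ℝ) : ℂ) * ψ ξ := by
        refine integral_congr_ae (.of_forall fun x => ?_)
        simp only [Complex.ofReal_mul, mul_assoc]
        rw [integral_const_mul, ← integral_one_sub_cos_mul_schwartzMap]
        simp only [mul_assoc]
    _ = ∫ ξ : E, ∫ x : E, ((‖x‖ ^ (-(dim E + γ)) *
          (1 - Real.cos (2 * Real.pi * inner ℝ x ξ)) : ℝ) : ℂ) * ψ ξ :=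
        integral_integral_swap (integrable_prod_norm_rpow_mul_one_sub_cos hγ ψ)
    _ = _ := by
        rw [← integral_const_mul]
        refine integral_congr_ae (.of_forall fun ξ => ?_)
        simp only []
        rw [integral_mul_const, integral_complex_ofReal, integral_norm_rpow_mul_one_sub_cos hγ]
        push_cast
        ring

/-! ### Truncated integrals and the finite part -/

lemma measurableSet_lt_norm {E : Type*} [NormedAddCommGroup E] [MeasurableSpace E] [BorelSpace E]
    (ε : ℝ) : MeasurableSet {x : E | ε < ‖x‖} :=
  measurableSet_lt measurable_const measurable_norm

lemma indicator_lt_norm {E : Type*} [NormedAddCommGroup E] (f : ℝ → ℝ) (ε : ℝ) :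
    {x : E | ε < ‖x‖}.indicator (fun x => f ‖x‖) = fun x => (Ioi ε).indicator f ‖x‖ := by
  ext x
  simp [indicator]

lemma pow_smul_indicator_rpow {d : ℕ} (hd : 1 ≤ d) {γ ε : ℝ} (hε : 0 < ε) :
    (fun y : ℝ => y ^ (d - 1) • (Ioi ε).indicator (fun r => r ^ (-(d + γ))) y) =
      (Ioi ε).indicator fun y => y ^ (-(1 + γ)) := by
  ext y
  by_cases hy : y ∈ Ioi ε
  · have hy0 : 0 < y := hε.trans hy
    rw [indicator_of_mem hy, indicator_of_mem hy, smul_eq_mul, ← Real.rpow_natCast,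
      ← Real.rpow_add hy0, Nat.cast_sub hd]
    push_cast
    ring_nf
  · simp [indicator_of_notMem hy]

lemma integrableOn_norm_rpow_lt_norm [Nontrivial E] {γ ε : ℝ} (hγ : 0 < γ) (hε : 0 < ε) :
    IntegrableOn (fun x : E => ‖x‖ ^ (-(dim E + γ))) {x | ε < ‖x‖} := by
  rw [← integrable_indicator_iff (measurableSet_lt_norm ε),
    indicator_lt_norm (fun r => r ^ (-(dim E + γ))), integrable_fun_norm_addHaar,
    pow_smul_indicator_rpow Module.finrank_pos hε]
  refine Integrable.integrableOn ?_
  rw [integrable_indicator_iff measurableSet_Ioi]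
  exact integrableOn_Ioi_rpow_of_lt (by linarith) hε

lemma setIntegral_norm_rpow_lt_norm [Nontrivial E] {γ ε : ℝ} (hγ : 0 < γ) (hε : 0 < ε) :
    ∫ x in {x : E | ε < ‖x‖}, ‖x‖ ^ (-(dim E + γ)) =
      dim E * volume.real (Metric.ball (0 : E) 1) / γ * ε ^ (-γ) := by
  rw [← integral_indicator (measurableSet_lt_norm ε),
    indicator_lt_norm (fun r => r ^ (-(dim E + γ))), integral_fun_norm_addHaar,
    pow_smul_indicator_rpow Module.finrank_pos hε, setIntegral_indicator measurableSet_Ioi,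
    inter_eq_right.2 (Ioi_subset_Ioi hε.le), integral_Ioi_rpow_of_lt (by linarith) hε]
  simp only [nsmul_eq_mul, smul_eq_mul]
  rw [show -(1 + γ) + 1 = -γ by ring]
  field_simp

lemma integrableOn_norm_rpow_mul_schwartzMap [Nontrivial E] {γ ε : ℝ} (hγ : 0 < γ) (hε : 0 < ε)
    (φ : 𝓢(E, ℂ)) :
    IntegrableOn (fun x : E => ((‖x‖ ^ (-(dim E + γ)) : ℝ) : ℂ) * φ x) {x | ε < ‖x‖} := by
  obtain ⟨C, hC⟩ := φ.decay 0 0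
  refine (integrableOn_norm_rpow_lt_norm hγ hε).ofReal.mul_bdd (c := C)
    φ.continuous.aestronglyMeasurable (.of_forall fun x => ?_)
  simpa using hC.2 x

lemma setIntegral_neg_lt_norm (f : E → ℂ) (ε : ℝ) :
    ∫ x in {x : E | ε < ‖x‖}, f (-x) = ∫ x in {x : E | ε < ‖x‖}, f x := by
  rw [← integral_indicator (measurableSet_lt_norm ε), ← integral_indicator (measurableSet_lt_norm ε),
    ← integral_neg_eq_self]
  refine integral_congr_ae (.of_forall fun x => ?_)
  simp [indicator]

lemma integrableOn_comp_neg_lt_norm {f : E → ℂ} {ε : ℝ} (hf : IntegrableOn f {x : E | ε < ‖x‖}) :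
    IntegrableOn (fun x => f (-x)) {x : E | ε < ‖x‖} := by
  rw [← integrable_indicator_iff (measurableSet_lt_norm ε)] at hf ⊢
  refine hf.comp_neg.congr (.of_forall fun x => ?_)
  simp [indicator]

/-- The truncated region and the weight are even, so averaging over `±x` costs nothing; the `φ(0)`
term yields the whole divergent part. -/
lemma setIntegral_norm_rpow_mul_symm_diff [Nontrivial E] {γ ε : ℝ} (hγ : 0 < γ) (hε : 0 < ε)
    (φ : 𝓢(E, ℂ)) :
    ∫ x in {x : E | ε < ‖x‖}, ((‖x‖ ^ (-(dim E + γ)) : ℝ) : ℂ) * (φ 0 - (φ x + φ (-x)) / 2) =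
      φ 0 * ((dim E * volume.real (Metric.ball (0 : E) 1) / γ : ℝ) : ℂ) * ((ε ^ (-γ) : ℝ) : ℂ) -
        ∫ x in {x : E | ε < ‖x‖}, ((‖x‖ ^ (-(dim E + γ)) : ℝ) : ℂ) * φ x := by
  have h0 : IntegrableOn (fun x : E => ((‖x‖ ^ (-(dim E + γ)) : ℝ) : ℂ)) {x | ε < ‖x‖} :=
    (integrableOn_norm_rpow_lt_norm hγ hε).ofReal
  have h1 := integrableOn_norm_rpow_mul_schwartzMap hγ hε φ
  have h2 := integrableOn_comp_neg_lt_norm h1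
  have e2 := setIntegral_neg_lt_norm (fun x => ((‖x‖ ^ (-(dim E + γ)) : ℝ) : ℂ) * φ x) ε
  have e0 : ∫ x in {x : E | ε < ‖x‖}, ((‖x‖ ^ (-(dim E + γ)) : ℝ) : ℂ) = _ :=
    integral_complex_ofReal.trans (congrArg _ (setIntegral_norm_rpow_lt_norm hγ hε))
  simp only [norm_neg] at h2 e2
  have hsub := integral_sub (h0.mul_const (φ 0)) ((h1.add h2).div_const 2)
  simp only [Pi.add_apply] at hsub
  calc _ = ∫ x in {x : E | ε < ‖x‖}, (((‖x‖ ^ (-(dim E + γ)) : ℝ) : ℂ) * φ 0 -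
          (((‖x‖ ^ (-(dim E + γ)) : ℝ) : ℂ) * φ x +
            ((‖x‖ ^ (-(dim E + γ)) : ℝ) : ℂ) * φ (-x)) / 2) := by
        congr 1 with x
        ring
    _ = _ := by
        rw [hsub, integral_div,
          integral_add h1 h2, e2, integral_mul_const, e0]
        push_cast
        ring

lemma tendsto_setIntegral_lt_norm [Nontrivial E] {f : E → ℂ} (hf : Integrable f) :
    Tendsto (fun ε : ℝ => ∫ x in {x : E | ε < ‖x‖}, f x) (𝓝[>] 0) (𝓝 (∫ x, f x)) := by
  refine AECover.integral_tendsto_of_countably_generated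
    (φ := fun ε : ℝ => {x : E | ε < ‖x‖}) ⟨?_, measurableSet_lt_norm⟩ hf
  filter_upwards [compl_mem_ae_iff.2 (measure_singleton (0 : E))] with x hx
  exact mem_nhdsWithin_of_mem_nhds (Iio_mem_nhds (norm_pos_iff.2 hx))

/-- The Hadamard finite part of `|x|^{-d-γ}`, tested against a Schwartz function. -/
lemma tendsto_setIntegral_norm_rpow_mul_schwartzMap [Nontrivial E] {γ : ℝ}
    (hγ : γ ∈ Ioo (0 : ℝ) 2) (φ : 𝓢(E, ℂ)) :
    Tendsto (fun ε : ℝ =>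
        (∫ x in {x : E | ε < ‖x‖}, ((‖x‖ ^ (-(dim E + γ)) : ℝ) : ℂ) * φ x) -
          φ 0 * ((dim E * volume.real (Metric.ball (0 : E) 1) / γ : ℝ) : ℂ) * ((ε ^ (-γ) : ℝ) : ℂ))
      (𝓝[>] 0)
      (𝓝 (kernelConst (dim E) γ * ∫ ξ : E, ((‖ξ‖ ^ γ : ℝ) : ℂ) * 𝓕⁻ φ ξ)) := by
  -- The symmetric-difference identity is used for `𝓕⁻ φ`, so that `φ` itself appears on the side of
  -- `x`.
  have hφ : 𝓕 (𝓕⁻ φ) = φ := FourierTransform.fourier_fourierInv_eq φ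
  have hint := integrable_norm_rpow_mul_symm_diff hγ (𝓕⁻ φ)
  have hval := integral_norm_rpow_mul_symm_diff hγ (𝓕⁻ φ)
  rw [hφ] at hint hval
  have hlim := (tendsto_setIntegral_lt_norm hint).neg
  rw [hval, neg_mul, neg_neg] at hlim
  refine hlim.congr' ?_
  filter_upwards [self_mem_nhdsWithin] with ε hε
  rw [setIntegral_norm_rpow_mul_symm_diff hγ.1 hε]
  ring

/-! ### Fourier transform of the finite part -/

/-- The measure `|ξ|^γ dξ`. -/
noncomputable def normRpowMeasure (E : Type*) [NormedAddCommGroup E] [InnerProductSpace ℝ E]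
    [FiniteDimensional ℝ E] [MeasurableSpace E] [BorelSpace E] (γ : ℝ) : Measure E :=
  volume.withDensity fun ξ => ((‖ξ‖ ^ γ).toNNReal : ENNReal)

lemma measurable_norm_rpow_toNNReal {E : Type*} [NormedAddCommGroup E] [MeasurableSpace E]
    [BorelSpace E] (γ : ℝ) : Measurable fun ξ : E => (‖ξ‖ ^ γ).toNNReal := by
  fun_prop

lemma hasTemperateGrowth_normRpowMeasure {γ : ℝ} (hγ : γ ∈ Icc (0 : ℝ) 2) :
    (normRpowMeasure E γ).HasTemperateGrowth := by
  obtain ⟨n, hn⟩ := (inferInstance : (volume : Measure E).HasTemperateGrowth).exists_integrable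
  -- Two extra powers of `1 + |ξ|` absorb the weight, since `γ ≤ 2`.
  refine ⟨n + 2, ?_⟩
  rw [normRpowMeasure, integrable_withDensity_iff_integrable_smul (measurable_norm_rpow_toNNReal γ)]
  refine hn.mono' (Measurable.aestronglyMeasurable (by fun_prop)) (.of_forall fun ξ => ?_)
  have h0 := norm_nonneg ξ
  have h1 : 0 < 1 + ‖ξ‖ := by positivity
  have h2 : ‖ξ‖ ^ γ ≤ (1 + ‖ξ‖) ^ 2 :=
    (rpow_le_one_add_sq h0 hγ).trans (by nlinarith)
  rw [NNReal.smul_def, Real.coe_toNNReal _ (Real.rpow_nonneg h0 _), smul_eq_mul,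
    Real.norm_of_nonneg (by positivity)]
  calc ‖ξ‖ ^ γ * (1 + ‖ξ‖) ^ (-((n + 2 : ℕ) : ℝ))
    _ ≤ (1 + ‖ξ‖) ^ 2 * (1 + ‖ξ‖) ^ (-((n + 2 : ℕ) : ℝ)) := by gcongr
    _ = (1 + ‖ξ‖) ^ (-(n : ℝ)) := by
        rw [← Real.rpow_two, ← Real.rpow_add h1]
        push_cast
        ring_nf

lemma integral_normRpowMeasure (γ : ℝ) (f : E → ℂ) :
    ∫ ξ, f ξ ∂(normRpowMeasure E γ) = ∫ ξ, ((‖ξ‖ ^ γ : ℝ) : ℂ) * f ξ := by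
  rw [normRpowMeasure, integral_withDensity_eq_integral_smul (measurable_norm_rpow_toNNReal γ)]
  refine integral_congr_ae (.of_forall fun ξ => ?_)
  simp only [NNReal.smul_def, Real.coe_toNNReal _ (Real.rpow_nonneg (norm_nonneg ξ) _),
    Complex.real_smul]

end Kernel

/-- The finite part of `A |x|^{-N-γ}` has Fourier transform `A c |ξ|^γ`. -/
lemma exists_isFinitePart_norm_rpow {N : ℕ} (hN : 1 ≤ N) (A : ℝ) {γ : ℝ}
    (hγ : γ ∈ Ioo (0 : ℝ) 2) :
    ∃ U : 𝓢'(Space N, ℂ), IsFinitePart (fun x => A * ‖x‖ ^ (-(N + γ))) U ∧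
      ∀ φ : 𝓢(Space N, ℂ), 𝓕 U φ =
        ∫ ξ, ((A * kernelConst N γ * ‖ξ‖ ^ γ : ℝ) : ℂ) * φ ξ := by
  have : Nontrivial (Space N) := by
    refine Module.nontrivial_of_finrank_pos (R := ℝ) ?_
    rw [finrank_euclideanSpace_fin]
    exact hN
  have := hasTemperateGrowth_normRpowMeasure (E := Space N) (Ioo_subset_Icc_self hγ)
  -- The distribution is defined on the Fourier side, so its transform comes from Fourier inversion
  -- and the content lies in the finite-part limit.
  refine ⟨𝓕⁻ (((A * kernelConst N γ : ℝ) : ℂ) • (normRpowMeasure (Space N) γ).toTemperedDistribution),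
    fun φ => ⟨fun ε hε => ?_, ?_⟩, fun φ => ?_⟩
  · have := (integrableOn_norm_rpow_mul_schwartzMap hγ.1 hε φ).const_mul (A : ℂ)
    rw [finrank_euclideanSpace_fin] at this
    refine this.congr (.of_forall fun x => ?_)
    push_cast
    ring
  · have hlim := (tendsto_setIntegral_norm_rpow_mul_schwartzMap hγ φ).const_mul (A : ℂ)
    rw [finrank_euclideanSpace_fin] at hlim
    -- Only `ε^{-γ}` diverges, with no logarithm; `N` times the volume of the unit ball is the area
    -- of the sphere.
    refine ⟨{γ}, fun _ => A * (φ 0 * ((N * volume.real (Metric.ball (0 : Space N) 1) / γ : ℝ) : ℂ)),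
      0, by simpa using hγ.1, ?_⟩
    convert! hlim using 2
    · rename_i ε
      rw [Finset.sum_singleton, mul_sub, ← integral_const_mul]
      simp only [Complex.ofReal_mul, mul_assoc, zero_mul, sub_zero]
    · rw [TemperedDistribution.fourierInv_apply]
      change _ * (normRpowMeasure (Space N) γ).toTemperedDistribution (𝓕⁻ φ) = _
      rw [Measure.toTemperedDistribution_apply (normRpowMeasure (Space N) γ),
        integral_normRpowMeasure]
      push_cast
      ring
  · rw [FourierTransform.fourier_fourierInv_eq]
    change _ * (normRpowMeasure (Space N) γ).toTemperedDistribution φ = _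
    rw [Measure.toTemperedDistribution_apply (normRpowMeasure (Space N) γ),
        integral_normRpowMeasure, ← integral_const_mul]
    simp only [Complex.ofReal_mul, mul_assoc]

/-! ### The Riesz constant and the potential of a power -/

lemma Gamma_neg_of_mem_Ioo {x : ℝ} (hx : x ∈ Ioo (-1 : ℝ) 0) : Real.Gamma x < 0 := by
  have h := Real.Gamma_add_one hx.2.ne
  have hpos : 0 < Real.Gamma (x + 1) := Real.Gamma_pos_of_pos (by linarith [hx.1])
  rw [h] at hpos
  exact neg_of_mul_pos_right hpos hx.2.le

/-- Both `(N - α)/2` and `(N - α + 2s)/2` lie in `(-1, 0)`, where Gamma is negative; one sits in the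
numerator, the other in the denominator. -/
lemma rieszConst_pos {N : ℕ} {s α : ℝ} (hs : 0 < s) (hα : α ∈ Ioo (N + 2 * s) ((N : ℝ) + 2)) :
    0 < rieszConst N s α := by
  have hN : (0 : ℝ) ≤ N := N.cast_nonneg
  obtain ⟨h1, h2⟩ := hα
  have g1 : Real.Gamma ((N - α) / 2) < 0 := Gamma_neg_of_mem_Ioo ⟨by linarith, by linarith⟩
  have g2 : Real.Gamma ((N - α + 2 * s) / 2) < 0 :=
    Gamma_neg_of_mem_Ioo ⟨by linarith, by linarith⟩
  have g3 : 0 < Real.Gamma ((α - 2 * s) / 2) := Real.Gamma_pos_of_pos (by linarith)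
  have g4 : 0 < Real.Gamma (α / 2) := Real.Gamma_pos_of_pos (by linarith)
  exact div_pos_of_neg_of_neg (mul_neg_of_pos_of_neg (by positivity) (mul_neg_of_neg_of_pos g1 g3))
    (mul_neg_of_pos_of_neg g4 g2)

lemma rieszConst_mul_kernelConst {N : ℕ} {s α : ℝ} (hs : 0 < s)
    (hα : α ∈ Ioo (N + 2 * s) ((N : ℝ) + 2)) :
    rieszConst N s α * kernelConst N (α - 2 * s - N) =
      (2 * Real.pi) ^ (-(2 * s)) * kernelConst N (α - N) := by
  have hN : (0 : ℝ) ≤ N := N.cast_nonneg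
  obtain ⟨h1, h2⟩ := hα
  have g2 : Real.Gamma ((N - α + 2 * s) / 2) ≠ 0 :=
    (Gamma_neg_of_mem_Ioo ⟨by linarith, by linarith⟩).ne
  have g3 : Real.Gamma ((α - 2 * s) / 2) ≠ 0 := (Real.Gamma_pos_of_pos (by linarith)).ne'
  have g4 : Real.Gamma (α / 2) ≠ 0 := (Real.Gamma_pos_of_pos (by linarith)).ne'
  have hπ : Real.pi ^ (α - 2 * s - N + N / 2) =
      Real.pi ^ (-(2 * s)) * Real.pi ^ (α - N + N / 2) := by
    rw [← Real.rpow_add Real.pi_pos]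
    ring_nf
  rw [rieszConst, kernelConst, kernelConst, hπ, Real.mul_rpow two_pos.le Real.pi_pos.le,
    show -((α - 2 * s - N) / 2) = (N - α + 2 * s) / 2 by ring,
    show (N + (α - 2 * s - N)) / 2 = (α - 2 * s) / 2 by ring,
    show -((α - N) / 2) = (N - α) / 2 by ring, show (N + (α - N)) / 2 = α / 2 by ring]
  field_simp

lemma integrable_const_mul_norm_rpow_mul_schwartzMap {N : ℕ} {γ : ℝ} (hγ : γ ∈ Ioo (0 : ℝ) 2)
    (A : ℝ) (φ : 𝓢(Space N, ℂ)) : Integrable fun ξ => ((A * ‖ξ‖ ^ γ : ℝ) : ℂ) * φ ξ := by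
  refine ((integrable_norm_rpow_mul_schwartzMap (Ioo_subset_Icc_self hγ) φ).const_mul
    (A : ℂ)).congr (.of_forall fun ξ => ?_)
  simp only [Complex.ofReal_mul, mul_assoc]

/-- `(-Δ)^{-s} |x|^{-α} = k(α) |x|^{-α+2s}` in the range where both sides are finite parts. -/
lemma isInverseFractionalLaplacian_norm_rpow {N : ℕ} (hN : 1 ≤ N) {s α : ℝ} (hs : 0 < s)
    (hα : α ∈ Ioo (N + 2 * s) ((N : ℝ) + 2)) (A : ℝ) :
    IsInverseFractionalLaplacian s (fun x : Space N => A * ‖x‖ ^ (-α))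
      (fun x => A * rieszConst N s α * ‖x‖ ^ (-(α - 2 * s))) := by
  have hγ : α - N ∈ Ioo (0 : ℝ) 2 := ⟨by linarith [hα.1], by linarith [hα.2]⟩
  have hγ' : α - 2 * s - N ∈ Ioo (0 : ℝ) 2 := ⟨by linarith [hα.1], by linarith [hα.2]⟩
  obtain ⟨U, hU, hFU⟩ := exists_isFinitePart_norm_rpow hN A hγ
  obtain ⟨P, hP, hFP⟩ := exists_isFinitePart_norm_rpow hN (A * rieszConst N s α) hγ'
  rw [add_sub_cancel] at hU hP
  have hmul : ∀ ξ : Space N, (((2 * Real.pi * ‖ξ‖) ^ (-(2 * s)) : ℝ) : ℂ) *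
      ((A * kernelConst N (α - N) * ‖ξ‖ ^ (α - N) : ℝ) : ℂ) =
      ((A * rieszConst N s α * kernelConst N (α - 2 * s - N) * ‖ξ‖ ^ (α - 2 * s - N) : ℝ) : ℂ) := by
    intro ξ
    rw [← Complex.ofReal_mul, mul_assoc A (rieszConst N s α), rieszConst_mul_kernelConst hs hα,
      Real.mul_rpow (by positivity) (norm_nonneg _)]
    congr 1
    -- At `ξ = 0` the powers cannot be added, but `|ξ|^{α-N}` and `|ξ|^{α-2s-N}` both vanish there.
    rcases (norm_nonneg ξ).eq_or_lt with h | h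
    · rw [← h, Real.zero_rpow hγ.1.ne', Real.zero_rpow hγ'.1.ne']
      simp
    · rw [show α - 2 * s - N = -(2 * s) + (α - N) by ring, Real.rpow_add h]
      ring
  refine ⟨U, P, hU, hP, fun ξ => ((A * kernelConst N (α - N) * ‖ξ‖ ^ (α - N) : ℝ) : ℂ), fun φ =>
    ⟨⟨integrable_const_mul_norm_rpow_mul_schwartzMap hγ _ φ, hFU φ⟩, ?_⟩⟩
  simp only [hmul]
  exact ⟨integrable_const_mul_norm_rpow_mul_schwartzMap hγ' _ φ, hFP φ⟩

/-! ### Calculus of radial powers -/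

lemma hasGradientAt_norm_rpow {N : ℕ} (q : ℝ) {x : Space N} (hx : x ≠ 0) :
    HasGradientAt (fun y : Space N => ‖y‖ ^ q) ((q * ‖x‖ ^ (q - 2)) • x) x := by
  have hpos : 0 < ‖x‖ := norm_pos_iff.2 hx
  have hsq : (fun y : Space N => ‖y‖ ^ q) = fun y => (‖y‖ ^ 2) ^ (q / 2) := by
    ext y
    rw [← Real.rpow_natCast, ← Real.rpow_mul (norm_nonneg y)]
    congr 1
    push_cast
    ring
  rw [hasGradientAt_iff_hasFDerivAt, hsq]
  have h := (hasStrictFDerivAt_norm_sq x).hasFDerivAt.rpow_const (p := q / 2)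
    (Or.inl (by positivity))
  convert! h using 1
  ext y
  have hexp : (‖x‖ ^ 2) ^ (q / 2 - 1) = ‖x‖ ^ (q - 2) := by
    rw [← Real.rpow_natCast, ← Real.rpow_mul (norm_nonneg x)]
    congr 1
    push_cast
    ring
  simp only [InnerProductSpace.toDual_apply_apply, real_inner_smul_left, hexp,
    smul_apply, innerSL_apply_apply, smul_eq_mul, nsmul_eq_mul]
  push_cast
  ring

lemma divergence_norm_rpow_smul {N : ℕ} (C q : ℝ) {x : Space N} (hx : x ≠ 0) :
    divergence (fun y : Space N => (C * ‖y‖ ^ q) • y) x = C * (N + q) * ‖x‖ ^ q := by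
  have hpos : 0 < ‖x‖ := norm_pos_iff.2 hx
  have hF := (((hasGradientAt_iff_hasFDerivAt.1 (hasGradientAt_norm_rpow q hx)).const_mul C).smul
    (hasFDerivAt_id x))
  have hF' : fderiv ℝ (fun y : Space N => (C * ‖y‖ ^ q) • y) x = _ := hF.fderiv
  have hsum : ∑ i, x i ^ 2 = ‖x‖ ^ 2 := by
    rw [EuclideanSpace.norm_sq_eq]
    simp
  have hq : ‖x‖ ^ q = ‖x‖ ^ (q - 2) * ‖x‖ ^ 2 := by
    rw [← Real.rpow_two, ← Real.rpow_add hpos]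
    ring_nf
  have hterm : ∀ i : Fin N, fderiv ℝ (fun y : Space N => (C * ‖y‖ ^ q) • y) x
      (EuclideanSpace.single i 1) i = C * ‖x‖ ^ q + C * q * ‖x‖ ^ (q - 2) * x i ^ 2 := by
    intro i
    rw [hF']
    simp [EuclideanSpace.inner_single_right]
    ring
  rw [divergence, Finset.sum_congr rfl fun i _ => hterm i, Finset.sum_add_distrib,
    ← Finset.mul_sum Finset.univ (fun i => x i ^ 2), hsum]
  simp only [Finset.sum_const, Finset.card_univ, Fintype.card_fin, nsmul_eq_mul]
  rw [mul_assoc (C * q), ← hq]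
  ring

/-- In polar coordinates the density is `y^{N-1-α}`, with exponent at most `-1`. -/
lemma lintegral_ball_norm_rpow_eq_top {N : ℕ} (hN : 1 ≤ N) {A α r : ℝ} (hA : 0 < A)
    (hα : (N : ℝ) ≤ α) (hr : 0 < r) :
    ∫⁻ x in Metric.ball (0 : Space N) r, ENNReal.ofReal (A * ‖x‖ ^ (-α)) = ⊤ := by
  have : Nontrivial (Space N) := by
    refine Module.nontrivial_of_finrank_pos (R := ℝ) ?_
    rw [finrank_euclideanSpace_fin]
    exact hN
  by_contra htop
  have hint : IntegrableOn (fun x : Space N => A * ‖x‖ ^ (-α)) (Metric.ball 0 r) :=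
    (lintegral_ofReal_ne_top_iff_integrable (Measurable.aestronglyMeasurable (by fun_prop))
      (.of_forall fun x => by positivity)).1 htop
  rw [integrableOn_fun_norm_addHaar volume (f := fun y => A * y ^ (-α)),
    finrank_euclideanSpace_fin] at hint
  have hpow : IntegrableOn (fun y : ℝ => y ^ ((N : ℝ) - 1 - α)) (Ioo 0 r) := by
    refine IntegrableOn.congr_fun (hint.const_mul A⁻¹) (fun y hy => ?_) measurableSet_Ioo
    simp only [smul_eq_mul]
    rw [show (N : ℝ) - 1 - α = ((N - 1 : ℕ) : ℝ) + -α by push_cast [Nat.cast_sub hN]; ring,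
      Real.rpow_add hy.1, Real.rpow_natCast]
    field_simp
  rw [intervalIntegral.integrableOn_Ioo_rpow_iff hr] at hpow
  linarith

lemma contDiffAt_norm_rpow {N : ℕ} (q : ℝ) {n : WithTop ℕ∞} {x : Space N} (hx : x ≠ 0) :
    ContDiffAt ℝ n (fun y : Space N => ‖y‖ ^ q) x :=
  (contDiffAt_norm ℝ hx).rpow_const_of_ne (norm_ne_zero_iff.2 hx)

/-- The pressure equation for `A t^{1/(1-m)} |x|^{-α}`, with `α (1 - m) = 2 - 2 s`. -/
lemma divergence_rpow_smul_gradient {N : ℕ} {s m α k V : ℝ} (hV : 0 < V)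
    (hα : α * (1 - m) = 2 - 2 * s) {x : Space N} (hx : x ≠ 0) :
    divergence (fun y : Space N => (V * ‖y‖ ^ (-α)) ^ (m - 1) •
      gradient (fun z : Space N => V * k * ‖z‖ ^ (-(α - 2 * s))) y) x =
      V ^ m * k * (α - 2 * s) * (α - N) * ‖x‖ ^ (-α) := by
  have heq : (fun y : Space N => (V * ‖y‖ ^ (-α)) ^ (m - 1) •
      gradient (fun z : Space N => V * k * ‖z‖ ^ (-(α - 2 * s))) y) =ᶠ[𝓝 x]
      fun y => (-(V ^ m * k * (α - 2 * s)) * ‖y‖ ^ (-α)) • y := by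
    filter_upwards [isOpen_compl_singleton.mem_nhds hx] with y hy
    have hy0 : 0 < ‖y‖ := norm_pos_iff.2 hy
    have hgrad : gradient (fun z : Space N => V * k * ‖z‖ ^ (-(α - 2 * s))) y =
        (V * k) • ((-(α - 2 * s) * ‖y‖ ^ (-(α - 2 * s) - 2)) • y) := by
      refine HasGradientAt.gradient ?_
      have := (hasGradientAt_iff_hasFDerivAt.1
        (hasGradientAt_norm_rpow (-(α - 2 * s)) hy)).const_mul (V * k)
      rw [hasGradientAt_iff_hasFDerivAt, map_smul]
      exact this
    rw [hgrad, Real.mul_rpow hV.le (by positivity), ← Real.rpow_mul hy0.le, smul_smul, smul_smul]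
    congr 1
    have e1 : V ^ m = V ^ (m - 1) * V := by
      rw [← Real.rpow_add_one hV.ne']
      ring_nf
    -- This balance of exponents is exactly `α (1 - m) = 2 - 2s`.
    have e2 : ‖y‖ ^ (-α) = ‖y‖ ^ (-α * (m - 1)) * ‖y‖ ^ (-(α - 2 * s) - 2) := by
      rw [← Real.rpow_add hy0]
      congr 1
      linarith
    rw [e1, e2]
    ring
  rw [divergence, heq.fderiv_eq]
  exact (divergence_norm_rpow_smul _ _ hx).trans (by ring)

/-! ### The separable solution -/

lemma deriv_const_mul_rpow_mul {K a c t : ℝ} (ht : 0 < t) :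
    deriv (fun τ : ℝ => K * τ ^ a * c) t = K * a * t ^ (a - 1) * c := by
  have := (((Real.hasDerivAt_rpow_const (p := a) (Or.inl ht.ne')).const_mul K).mul_const c).deriv
  rw [this]
  ring

/-- The separable solution `K t^{1/(1-m)} |x|^{-α}` is very singular. -/
lemma isVerySingularSolution_separable {N : ℕ} (hN : 1 ≤ N) {s m α K : ℝ} (hs : 0 < s)
    (hm : m < 1) (hα : α * (1 - m) = 2 - 2 * s) (hα' : α ∈ Ioo (N + 2 * s) ((N : ℝ) + 2))
    (hK : 0 < K)
    (hKm : K ^ (1 - m) = rieszConst N s α * (α - 2 * s) * ((α - N) * (1 - m))) :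
    IsVerySingularSolution s m
      (fun (t : ℝ) (x : Space N) => K * t ^ (1 / (1 - m)) * ‖x‖ ^ (-α)) := by
  have hm' : 0 < 1 - m := by linarith
  have hα0 : 0 < α := by have : (0 : ℝ) ≤ N := N.cast_nonneg; linarith [hα'.1]
  refine ⟨⟨fun t ht x hx => ?_, ?_, ?_⟩, fun r hr => ?_, fun t ht r hr => ?_⟩
  · have : 0 < t := ht
    have := norm_pos_iff.2 hx
    positivity
  · rintro ⟨t, x⟩ ⟨ht, hx⟩
    refine ContDiffAt.contDiffWithinAt (ContDiffAt.mul (contDiffAt_const.mul ?_) ?_)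
    · exact contDiffAt_fst.rpow_const_of_ne (ne_of_gt ht)
    · exact (contDiffAt_norm_rpow (-α) (x := x) hx).comp (t, x) contDiffAt_snd
  · refine ⟨fun t x => K * t ^ (1 / (1 - m)) * rieszConst N s α * ‖x‖ ^ (-(α - 2 * s)),
      fun t ht => ⟨isInverseFractionalLaplacian_norm_rpow hN hs hα' _, fun x hx =>
        (contDiffAt_const.mul (contDiffAt_norm_rpow _ hx)).contDiffWithinAt, fun x hx => ?_⟩⟩
    have ht : 0 < t := ht
    have hV : 0 < K * t ^ (1 / (1 - m)) := by positivity
    rw [divergence_rpow_smul_gradient hV hα hx, deriv_const_mul_rpow_mul ht]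
    congr 1
    have e1 : (K * t ^ (1 / (1 - m))) ^ m = K ^ m * t ^ (1 / (1 - m) - 1) := by
      rw [Real.mul_rpow hK.le (by positivity), ← Real.rpow_mul ht.le]
      congr 2
      field_simp
      ring
    have e2 : K = K ^ (1 - m) * K ^ m := by
      rw [← Real.rpow_add hK, sub_add_cancel, Real.rpow_one]
    -- With the powers of `t` and `|x|` matched, this is all that the equation still asks of `K`.
    have e3 : K * (1 / (1 - m)) = K ^ m * rieszConst N s α * (α - 2 * s) * (α - N) := by
      nth_rewrite 1 [e2]
      rw [hKm]
      field_simp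
    rw [e1, e3]
    ring
  · rw [Metric.tendstoUniformlyOn_iff]
    intro ε hε
    have hlim : Tendsto (fun t : ℝ => K * t ^ (1 / (1 - m)) * r ^ (-α)) (𝓝[>] 0) (𝓝 0) := by
      have hc : ContinuousAt (fun t : ℝ => K * t ^ (1 / (1 - m)) * r ^ (-α)) 0 :=
        ((Real.continuousAt_rpow_const _ _ (Or.inr (by positivity))).const_mul K).mul_const _
      have := hc.tendsto
      rw [Real.zero_rpow (by positivity), mul_zero, zero_mul] at this
      exact this.mono_left nhdsWithin_le_nhds
    filter_upwards [hlim.eventually (gt_mem_nhds hε), self_mem_nhdsWithin] with t htε ht x hx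
    have ht : 0 < t := ht
    have hx : r ≤ ‖x‖ := hx
    rw [Pi.zero_apply, dist_zero_left, Real.norm_of_nonneg (by positivity)]
    refine lt_of_le_of_lt ?_ htε
    gcongr ?_ * ?_
    -- The power decreases in `|x|`, so its value at radius `r` bounds it uniformly.
    exact Real.rpow_le_rpow_of_nonpos hr hx (by linarith)
  · exact lintegral_ball_norm_rpow_eq_top hN (by have : 0 < t := ht; positivity)
      (by linarith [hα'.1]) hr

end FractionalPressure

theorem mainTheorem5 (N : ℕ) (hN : 1 ≤ N) (s m : ℝ) (hs : s ∈ Set.Ioo (0 : ℝ) 1)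
    (hm : m ∈ Set.Ioo (((N : ℝ) - 2 + 4 * s) / (N + 2 * s)) (((N : ℝ) + 2 * s) / (N + 2))) :
    ∃ K : ℝ, 0 < K ∧
      K ^ (1 - m) =
        FractionalPressure.rieszConst N s ((2 - 2 * s) / (1 - m)) *
          ((2 - 2 * s) / (1 - m) - 2 * s) * ((N : ℝ) * (m - 1) + 2 - 2 * s) ∧
      FractionalPressure.IsVerySingularSolution s m
        (fun (t : ℝ) (x : FractionalPressure.Space N) =>
          K * t ^ (1 / (1 - m)) * ‖x‖ ^ (-((2 - 2 * s) / (1 - m)))) := by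
  obtain ⟨hs0, hs1⟩ := hs
  obtain ⟨hm1, hm2⟩ := hm
  have hN0 : (0 : ℝ) ≤ N := N.cast_nonneg
  -- Cleared of denominators, the two bounds on `m` become `(N + 2s)(1 - m) < 2 - 2s < (N + 2)(1 -
  -- m)`, the required range of `α`.
  rw [div_lt_iff₀ (by positivity)] at hm1
  rw [lt_div_iff₀ (by positivity)] at hm2
  have hm' : 0 < 1 - m := by nlinarith
  set α := (2 - 2 * s) / (1 - m) with hαdef
  have hα : α * (1 - m) = 2 - 2 * s := div_mul_cancel₀ _ hm'.ne'
  have hα' : α ∈ Set.Ioo (N + 2 * s) ((N : ℝ) + 2) := by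
    constructor
    · rw [hαdef, lt_div_iff₀ hm']
      linarith
    · rw [hαdef, div_lt_iff₀ hm']
      linarith
  have hfac : (N : ℝ) * (m - 1) + 2 - 2 * s = (α - N) * (1 - m) := by linarith
  set R := FractionalPressure.rieszConst N s α * (α - 2 * s) * ((α - N) * (1 - m)) with hR
  have hRpos : 0 < R := by
    have h1 := FractionalPressure.rieszConst_pos hs0 hα'
    have h2 : 0 < α - 2 * s := by linarith [hα'.1]
    have h3 : 0 < α - N := by linarith [hα'.1]
    positivity
  have hK : (R ^ (1 / (1 - m))) ^ (1 - m) = R := by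
    rw [← Real.rpow_mul hRpos.le, one_div, inv_mul_cancel₀ hm'.ne', Real.rpow_one]
  refine ⟨R ^ (1 / (1 - m)), Real.rpow_pos_of_pos hRpos _, ?_, ?_⟩
  · rw [hK, hfac]
  · exact FractionalPressure.isVerySingularSolution_separable hN hs0 (by linarith) hα hα'
      (Real.rpow_pos_of_pos hRpos _) hK
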